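/- Let $\beta,\gamma\in(0,1)$, $t_1,t_2>0$, $d\in\mathbb N$ and $x\in\mathbb R^d$. For $\alpha\in(0,1)$ and $t>0$ let $X^\alpha_t$ be the decreasing $\alpha$-stable process started at $t$ and absorbed at $0$ on an attempt to cross it, i.e. $X^\alpha_t(s)=\max(t-S^\alpha(s),0)$, where $S^\alpha$ is an $\alpha$-stable subordinator with $\mathbb E[e^{-\lambda S^\alpha(s)}]=e^{-s\lambda^\alpha}$ (so that $X^\alpha_t$ is generated by $-D^\alpha_{0+*}$, minus the Caputo derivative of order $\alpha$). Let $\tau_0^\beta=\inf\{s>0: X^\beta_{t_1}(s)\le 0\}$ and $\tau_0^\gamma=\inf\{s>0: X^\gamma_{t_2}(s)\le 0\}$. Let $a$ be a measurable, symmetric, bounded and uniformly elliptic matrix-valued function on $\mathbb R^d$, and let $Y_x$ be the diffusion started at $x$ whose transition densities $p^Y(s,x,y)$ are those of the Feller semigroup generated by $L=\nabla\cdot(a\nabla)$ (in the weak sense). Assume that $X^\beta_{t_1}$, $X^\gamma_{t_2}$ and $Y_x$ are independent. Then $X^\beta$ and $X^\gamma$ have jointly measurable transition densities $p^\beta_s(t,r)$,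 $p^\gamma_s(t,r)$ on $r>0$ (i.e. $\mathbb P[X^\alpha_t(s)\in B]=\int_B p^\alpha_s(t,r)\,dr$ for Borel $B\subset(0,\infty)$, $s,t>0$), the exit times $\tau_0^\beta,\tau_0^\gamma$ have probability densities $\mu_0^\beta,\mu_0^\gamma$ on $(0,\infty)$, and for any versions of these densities the following holds. For every measurable $\phi_1:\mathbb R\times\mathbb R^d\to\mathbb R$ such that $\phi_1(X^\gamma_{t_2}(\tau_0^\beta),Y_x(\tau_0^\beta))\mathbf 1_{\{\tau_0^\beta<\tau_0^\gamma\}}$ is integrable (for example $\phi_1$ bounded), $$\mathbb E\left[\phi_1\bigl(X_{t_2}^\gamma(\tau_0^\beta), Y_x(\tau_0^\beta)\bigr)\mathbf 1_{\{\tau_0^\beta < \tau_0^\gamma\}}\right] = \int_0^{t_2}\int_{\mathbb R^d}\phi_1(r, y) \int_0^\infty p^Y(s, x, y)\, p^\gamma_s(t_2, r)\, \mu_0^\beta(s)\,ds\,dy\,dr,$$ and for every measurable $\phi_2:\mathbb R\times\mathbb R^d\to\mathbb R$ such that $\phi_2(X^\beta_{t_1}(\tau_0^\gamma),Y_x(\tau_0^\gamma))\mathbf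 1_{\{\tau_0^\gamma<\tau_0^\beta\}}$ is integrable, $$\mathbb E\left[\phi_2\bigl(X_{t_1}^\beta(\tau_0^\gamma), Y_x(\tau_0^\gamma)\bigr)\mathbf 1_{\{\tau_0^\gamma< \tau_0^\beta\}}\right] = \int_0^{t_1}\int_{\mathbb R^d}\phi_2(r, y) \int_0^\infty p^Y(s, x, y)\, p^\beta_s(t_1, r)\, \mu_0^\gamma(s)\,ds\,dy\,dr.$$ In both cases the triple integral on the right converges absolutely. -/

import Mathlib

open MeasureTheory ProbabilityTheory Set Filter Topology
open scoped NNReal ZeroAtInfty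

noncomputable section

namespace MixedFractional

/-! ## Stable subordinators and their absorbed, reversed versions -/

variable {Ω : Type*} [MeasurableSpace Ω]

/-- `S` is a standard `α`-stable subordinator under `P`: it starts at `0`, has independent
increments, its increments are stationary with Laplace transform `exp (-(t - s) l ^ α)`, and its
paths are almost surely nondecreasing and right-continuous. -/
structure IsStableSubordinator (α : ℝ) (S : ℝ≥0 → Ω → ℝ) (P : Measure Ω) : Prop where
  measurable : ∀ s, Measurable (S s)
  start : ∀ᵐ ω ∂P, S 0 ω = 0
  indep : HasIndepIncrements S P
  laplace : ∀ s t : ℝ≥0, s ≤ t → ∀ l : ℝ, 0 ≤ l →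
    ∫ ω, Real.exp (-l * (S t ω - S s ω)) ∂P = Real.exp (-((t : ℝ) - s) * l ^ α)
  mono : ∀ᵐ ω ∂P, Monotone fun s => S s ω
  rightCont : ∀ᵐ ω ∂P, ∀ s, ContinuousWithinAt (fun u => S u ω) (Ici s) s

/-- The process `X_t` generated by minus the Caputo derivative of order `α` on `[0, ∞)`, when `S` is
a standard `α`-stable subordinator: it starts at `t`, decreases as `t - S s`, and is absorbed at `0`
on an attempt to cross it (as `S` is nondecreasing, this is the positive part of `t - S s`). -/
def absorbed (t : ℝ) (S : ℝ≥0 → Ω → ℝ) (s : ℝ≥0) (ω : Ω) : ℝ := max (t - S s ω) 0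

/-- The exit time `τ₀ = inf {s > 0 : X s ≤ 0}`. For the processes used here the set is almost
surely nonempty, so the value of the infimum of the empty set plays no role. -/
def exitTime (X : ℝ≥0 → Ω → ℝ) (ω : Ω) : ℝ≥0 := sInf {s | 0 < s ∧ X s ω ≤ 0}

/-- `p s t r` is the transition density (on `(0, ∞)`, that is, before absorption) of the process
`absorbed t S`: for each starting point `t > 0` and each time `s > 0`, the law of `X_t(s)` restricted
to `(0, ∞)` is `p s t r dr`. -/
structure IsAbsorbedDensity (S : ℝ≥0 → Ω → ℝ) (P : Measure Ω) (p : ℝ → ℝ → ℝ → ℝ) : Prop where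
  measurable : ∀ t : ℝ, 0 < t → Measurable fun q : ℝ × ℝ => p q.1 t q.2
  nonneg : ∀ s t r : ℝ, 0 < s → 0 < t → 0 < r → 0 ≤ p s t r
  law : ∀ (s : ℝ≥0) (t : ℝ), 0 < s → 0 < t →
    (P.map (absorbed t S s)).restrict (Ioi 0) =
      (volume.restrict (Ioi 0)).withDensity fun r => ENNReal.ofReal (p s t r)

/-- `μ` is the probability density, on `(0, ∞)`, of the random time `τ`. -/
structure IsTimeDensity (τ : Ω → ℝ≥0) (P : Measure Ω) (μ : ℝ → ℝ) : Prop where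
  measurable : Measurable μ
  nonneg : ∀ s : ℝ, 0 < s → 0 ≤ μ s
  law : P.map (fun ω => (τ ω : ℝ)) =
    (volume.restrict (Ioi 0)).withDensity fun s => ENNReal.ofReal (μ s)

/-! ## Diffusions generated by a divergence form operator -/

/-- The space `ℝ^d` with its Euclidean norm. -/
abbrev E (d : ℕ) : Type := EuclideanSpace ℝ (Fin d)

/-- The partial derivative `∂ψ/∂x_i` at `x`. -/
def partialDeriv {d : ℕ} (i : Fin d) (ψ : E d → ℝ) (x : E d) : ℝ :=
  fderiv ℝ ψ x (EuclideanSpace.single i 1)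

/-- `a` is measurable, symmetric, bounded and uniformly elliptic. -/
structure IsEllipticCoefficient {d : ℕ} (a : E d → Matrix (Fin d) (Fin d) ℝ) : Prop where
  measurable : ∀ i j, Measurable fun x => a x i j
  symm : ∀ x, (a x).IsSymm
  elliptic : ∃ c C : ℝ, 0 < c ∧ ∀ x ξ : E d,
    c * ‖ξ‖ ^ 2 ≤ ∑ i, ∑ j, a x i j * ξ j * ξ i ∧
      ∑ i, ∑ j, a x i j * ξ j * ξ i ≤ C * ‖ξ‖ ^ 2

/-- `v` is the weak gradient of `u` and it is locally square integrable. -/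
structure IsWeakGradient {d : ℕ} (u : E d → ℝ) (v : E d → E d) : Prop where
  memLp : ∀ K : Set (E d), IsCompact K → MemLp v 2 (volume.restrict K)
  weak : ∀ ψ : E d → ℝ, ContDiff ℝ (⊤ : ℕ∞) ψ → HasCompactSupport ψ → ∀ i,
    ∫ x, u x * partialDeriv i ψ x = -∫ x, v x i * ψ x

/-- `∇ · (a ∇ u) = g` in the weak sense, with `u` locally in `H¹`. -/
def WeakDivGrad {d : ℕ} (a : E d → Matrix (Fin d) (Fin d) ℝ) (u g : E d → ℝ) : Prop :=
  ∃ v : E d → E d, IsWeakGradient u v ∧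
    ∀ ψ : E d → ℝ, ContDiff ℝ (⊤ : ℕ∞) ψ → HasCompactSupport ψ →
      ∫ x, ∑ i, ∑ j, a x i j * v x j * partialDeriv i ψ x = -∫ x, g x * ψ x

/-- The operator `T_s f (x) = ∫ p(s, x, y) f(y) dy`. -/
def transOp {d : ℕ} (p : ℝ → E d → E d → ℝ) (s : ℝ) (f : E d → ℝ) (x : E d) : ℝ :=
  ∫ y, p s x y * f y

/-- `p s x y` is a transition density of the diffusion with generator `L = ∇ · (a ∇)`: the
operators `T_s` form a conservative Feller semigroup on the space `C₀` of continuous functions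
vanishing at infinity, whose generator is `L`, that is, `(T_s u - u) / s → g` uniformly as `s ↓ 0`
if and only if `∇ · (a ∇ u) = g` weakly (for `u` and `g` in `C₀`). -/
structure IsDiffusionDensity {d : ℕ} (a : E d → Matrix (Fin d) (Fin d) ℝ)
    (p : ℝ → E d → E d → ℝ) : Prop where
  measurable : Measurable fun q : ℝ × E d × E d => p q.1 q.2.1 q.2.2
  nonneg : ∀ s : ℝ, 0 < s → ∀ x y, 0 ≤ p s x y
  mass : ∀ s : ℝ, 0 < s → ∀ x, ∫⁻ y, ENNReal.ofReal (p s x y) = 1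
  feller : ∀ s : ℝ, 0 < s → ∀ f : C₀(E d, ℝ), ∃ g : C₀(E d, ℝ), ∀ x, g x = transOp p s f x
  semigroup : ∀ s t : ℝ, 0 < s → 0 < t → ∀ (f : C₀(E d, ℝ)) (x : E d),
    transOp p (s + t) f x = transOp p s (transOp p t f) x
  strongCont : ∀ f : C₀(E d, ℝ), TendstoUniformly (fun s => transOp p s f) f (𝓝[>] (0 : ℝ))
  generator : ∀ u g : C₀(E d, ℝ),
    TendstoUniformly (fun (s : ℝ) x => (transOp p s u x - u x) / s) g (𝓝[>] (0 : ℝ)) ↔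
      WeakDivGrad a u g

/-- `Y` is the diffusion started at `x` with transition densities `p`: its paths are almost surely
continuous, and it is a Markov process (in its own filtration) with transition function
`p(h, x, y) dy`. -/
structure IsDiffusionFrom {d : ℕ} (p : ℝ → E d → E d → ℝ) (x : E d) (Y : ℝ≥0 → Ω → E d)
    (P : Measure Ω) : Prop where
  measurable : ∀ s, Measurable (Y s)
  start : ∀ᵐ ω ∂P, Y 0 ω = x
  cont : ∀ᵐ ω ∂P, Continuous fun s => Y s ω
  markov : ∀ s h : ℝ≥0, 0 < h → ∀ B : Set (E d), MeasurableSet B →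
    P⟦Y (s + h) ⁻¹' B | ⨆ u : Iic s, MeasurableSpace.comap (Y u) inferInstance⟧ =ᵐ[P]
      fun ω => ∫ y in B, p h (Y s ω) y

/-! ## The two sides of the representation -/

/-- The random variable `φ(X(τ), Y(τ)) 1_{τ < τ'}`. -/
def boundaryTerm {d : ℕ} (φ : ℝ → E d → ℝ) (X : ℝ≥0 → Ω → ℝ) (Y : ℝ≥0 → Ω → E d)
    (τ τ' : Ω → ℝ≥0) : Ω → ℝ :=
  {ω | τ ω < τ' ω}.indicator fun ω => φ (X (τ ω) ω) (Y (τ ω) ω)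

end MixedFractional

end

/-! Both formulas are a disintegration over the exit time of one process. Let `τ` be the exit time
of the first absorbed process and `X` the other one. Since `τ` is almost surely a functional of the
first path, it is independent of `X` and `Y`. Given `τ = s`, the pair `(X s, Y s)` therefore still
has a product law, with density `p s t r * pY s x y` on `r > 0`. The event that `τ` comes before the
exit time of `X` is almost surely `0 < X τ`, because `X` is monotone and reaches zero at its exit
time. So the indicator just restricts the law of `X s` to `r > 0`, and integrating over the law of
`τ` gives the joint density of `(X τ, Y τ, τ)` on that event (`lintegral_boundary`). Fubini does the
rest.

Existence of the densities rests on the stable law. Analytic continuation of the Laplace transform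
gives the characteristic function (`charFun_eq_of_laplace`), which is integrable because `cos (π α /
2) > 0`; hence `S s` has a density for `s > 0`. Self-similarity then makes the density at time 1
produce all the others and shows that the exit time has the law of `(t / S 1) ^ α`.

Evaluation at a random time is not measurable on the full path space, so `rightEval` recovers a
right-continuous path from rational times (`lintegral_eval_independent_time`). -/

namespace MixedFractional

/-! ### Characteristic functions and absolute continuity. -/

section

open scoped FourierTransform SchwartzMap Manifold ContDiff

/-- The integral of a test function against a finite measure is controlled by the `L¹` norms of the
test function and of the characteristic function of the measure. -/
lemma norm_integral_schwartz_le (ν : Measure ℝ) [IsProbabilityMeasure ν] (φ : 𝓢(ℝ, ℂ))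
    (hν : Integrable (charFun ν)) :
    ‖∫ x, φ x ∂ν‖ ≤ (∫ x, ‖φ x‖) * ∫ x, ‖charFun ν (-(2 * Real.pi) * x)‖ := by
  have hφ : (φ : ℝ → ℂ) = 𝓕 ((𝓕⁻ φ : 𝓢(ℝ, ℂ)) : ℝ → ℂ) := by
    rw [← SchwartzMap.fourier_coe, FourierTransform.fourier_fourierInv_eq]
  have h1 : ∫ x, φ x ∂ν =
      ∫ x, (𝓕⁻ φ : 𝓢(ℝ, ℂ)) x • charFun ν (-(2 * Real.pi) * x) := by
    -- Fubini moves the Fourier transform from the test function to `ν`, paired with the constant 1;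
    -- that transform of `ν` is its characteristic function rescaled by `-2π`.
    have := VectorFourier.integral_fourierIntegral_smul_eq_flip (μ := (volume : Measure ℝ))
      (ν := ν) (L := innerₗ ℝ) (f := (𝓕⁻ φ : 𝓢(ℝ, ℂ))) (g := fun _ => (1 : ℂ))
      Real.continuous_fourierChar (by fun_prop) (SchwartzMap.integrable _) (integrable_const _)
    rw [hφ]
    simp only [smul_eq_mul, mul_one] at this
    refine Eq.trans ?_ (this.trans ?_)
    · rfl
    · congr 1
      ext x
      rw [charFun_eq_fourierIntegral']
      simp only [smul_eq_mul]
      congr 1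
      have : -(2 * Real.pi)⁻¹ * (-(2 * Real.pi) * x) = x := by
        have := Real.pi_ne_zero
        field_simp
      rw [this]
      congr 1
      ext
      simp
  have hb : ∀ x, ‖(𝓕⁻ φ : 𝓢(ℝ, ℂ)) x‖ ≤ ∫ x, ‖φ x‖ := by
    intro x
    rw [SchwartzMap.fourierInv_coe, Real.fourierInv_eq]
    refine (norm_integral_le_integral_norm _).trans (le_of_eq ?_)
    simp
  have hi : Integrable fun x => charFun ν (-(2 * Real.pi) * x) :=
    hν.comp_mul_left' (by simp [Real.pi_ne_zero])
  rw [h1, ← integral_const_mul]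
  refine norm_integral_le_of_norm_le (hi.norm.const_mul _) (ae_of_all _ fun x => ?_)
  rw [norm_smul]
  gcongr
  exact hb x

/-- A probability measure on the line with integrable characteristic function is absolutely
continuous. -/
lemma absolutelyContinuous_of_integrable_charFun (ν : Measure ℝ) [IsProbabilityMeasure ν]
    (hν : Integrable (charFun ν)) : ν ≪ volume := by
  set C := ∫ x, ‖charFun ν (-(2 * Real.pi) * x)‖
  have hC : 0 ≤ C := integral_nonneg fun _ => norm_nonneg _
  -- By inner regularity, compact null sets suffice; each is squeezed between `f = 1` on `K` and `f
  -- = 0` off an open set of small volume, with `f` smooth.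
  have key : ∀ K : Set ℝ, IsCompact K → volume K = 0 → ν K = 0 := by
    intro K hK hK0
    have hle : ∀ ε : ℝ, 0 < ε → ν.real K ≤ ε * C := by
      intro ε hε
      obtain ⟨V, hKV, hVo, hV⟩ : ∃ V ⊇ K, IsOpen V ∧ volume V < ENNReal.ofReal ε :=
        K.exists_isOpen_lt_of_lt _ (by rw [hK0]; simpa using hε)
      obtain ⟨R, hR⟩ := hK.isBounded.subset_ball 0
      set U := V ∩ Metric.ball 0 R
      have hUo : IsOpen U := hVo.inter Metric.isOpen_ball
      have hKU : K ⊆ U := subset_inter hKV hR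
      have hU : volume.real U ≤ ε := by
        have : volume U ≤ ENNReal.ofReal ε := (measure_mono inter_subset_left).trans hV.le
        exact ENNReal.toReal_le_of_le_ofReal hε.le this
      have hUfin : volume U ≠ ⊤ :=
        ((measure_mono inter_subset_right).trans_lt measure_ball_lt_top).ne
      obtain ⟨f, hf0, hf1, hf⟩ := exists_contMDiffMap_zero_one_of_isClosed (n := ⊤) 𝓘(ℝ, ℝ)
        hUo.isClosed_compl hK.isClosed (disjoint_compl_left_iff_subset.2 hKU)
      have hsupp : Function.support f ⊆ U := by
        intro x hx
        by_contra h
        exact hx (hf0 h)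
      have hcs : HasCompactSupport f :=
        HasCompactSupport.intro (isCompact_closedBall (0 : ℝ) R) fun x hx => by
          by_contra h
          exact hx (Metric.ball_subset_closedBall (hsupp h).2)
      have hsm : ContDiff ℝ ∞ f := f.contMDiff.contDiff
      have hcs' : HasCompactSupport fun x => (f x : ℂ) :=
        hcs.comp_left (g := fun y : ℝ => (y : ℂ)) Complex.ofReal_zero
      set φ : 𝓢(ℝ, ℂ) := hcs'.toSchwartzMap (Complex.ofRealCLM.contDiff.comp hsm)
      have hφ : ∀ x, φ x = (f x : ℂ) := fun x => rfl
      have hmain := norm_integral_schwartz_le ν φ hν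
      simp only [hφ, integral_complex_ofReal] at hmain
      have hfi : ∀ μ : Measure ℝ, [IsFiniteMeasureOnCompacts μ] → Integrable f μ := fun μ _ =>
        hsm.continuous.integrable_of_hasCompactSupport hcs
      have h1 : ν.real K ≤ ∫ x, f x ∂ν := by
        rw [← integral_indicator_one hK.measurableSet]
        refine integral_mono ((integrable_const 1).indicator hK.measurableSet) (hfi ν) fun x => ?_
        by_cases hx : x ∈ K
        · simp [hx, hf1 hx]
        · simp [hx, (hf x).1]
      have h2 : ∫ x, ‖(f x : ℂ)‖ ≤ ε := by
        refine le_trans ?_ hU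
        rw [← integral_indicator_one hUo.measurableSet]
        refine integral_mono (by simpa using (hfi volume).norm)
          ((integrable_indicator_iff hUo.measurableSet).2 (integrableOn_const hUfin)) fun x => ?_
        by_cases hx : x ∈ U
        · simpa [hx, abs_of_nonneg (hf x).1] using (hf x).2
        · have : f x = 0 := hf0 hx
          simp [hx, this]
      calc ν.real K ≤ ∫ x, f x ∂ν := h1
        _ ≤ ‖((∫ x, f x ∂ν : ℝ) : ℂ)‖ := by
          rw [Complex.norm_real]; exact le_abs_self _
        _ ≤ _ := hmain
        _ ≤ ε * C := by gcongr
    have h0 : ν.real K ≤ 0 := by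
      refine ge_of_tendsto (x := 𝓝[>] (0 : ℝ)) (f := fun ε => ε * C) ?_ ?_
      · have : Tendsto (fun ε : ℝ => ε * C) (𝓝 0) (𝓝 (0 * C)) := tendsto_id.mul_const C
        rw [zero_mul] at this
        exact this.mono_left nhdsWithin_le_nhds
      · filter_upwards [self_mem_nhdsWithin] with ε hε using hle ε hε
    have := le_antisymm h0 measureReal_nonneg
    simpa [measureReal_eq_zero_iff] using this
  refine Measure.AbsolutelyContinuous.mk fun A hA hA0 => ?_
  by_contra h
  obtain ⟨K, hKA, hK, hνK⟩ := hA.exists_isCompact_lt_add (measure_ne_top ν A) h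
  rw [key K hK (measure_mono_null hKA hA0), zero_add] at hνK
  exact lt_irrefl _ hνK

/-- The Laplace transform `exp (-c l ^ α)` on the half line determines the characteristic
function. -/
lemma charFun_eq_of_laplace (ν : Measure ℝ) [IsProbabilityMeasure ν] (hν : ∀ᵐ x ∂ν, 0 ≤ x)
    {c α : ℝ} (hL : ∀ l : ℝ, 0 ≤ l → ∫ x, Real.exp (-l * x) ∂ν = Real.exp (-c * l ^ α))
    {θ : ℝ} (hθ : θ ≠ 0) :
    charFun ν θ = Complex.exp (-c * (-(θ * Complex.I)) ^ (α : ℂ)) := by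
  -- `ν` lives on the half line, so its complex moment generating function is analytic on the open
  -- left half-plane.
  have hsub : Iio (0 : ℝ) ⊆ interior (integrableExpSet id ν) := by
    refine interior_maximal (fun u hu => ?_) isOpen_Iio
    refine Integrable.of_bound (by fun_prop) 1 ?_
    filter_upwards [hν] with x hx
    rw [Real.norm_of_nonneg (Real.exp_pos _).le]
    exact Real.exp_le_one_iff.2 (mul_nonpos_of_nonpos_of_nonneg (le_of_lt hu) hx)
  set U : Set ℂ := {z | z.re < 0}
  have hf : AnalyticOnNhd ℂ (complexMGF id ν) U :=
    analyticOnNhd_complexMGF.mono fun z hz => hsub hz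
  set g : ℂ → ℂ := fun z => Complex.exp (-c * (-z) ^ (α : ℂ))
  have hgan : ∀ z : ℂ, -z ∈ Complex.slitPlane → AnalyticAt ℂ g z := fun z hz =>
    (analyticAt_const.mul (analyticAt_id.neg.cpow analyticAt_const hz)).cexp
  have hg : AnalyticOnNhd ℂ g U := fun z hz =>
    hgan z (Or.inl (by simpa using show z.re < 0 from hz))
  have hreal : ∀ u : ℝ, u < 0 → complexMGF id ν (u : ℂ) = g u := by
    intro u hu
    rw [complexMGF_ofReal, mgf]
    have := hL (-u) (by linarith)
    simp only [neg_neg] at this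
    simp only [id, this, g]
    rw [← Complex.ofReal_neg u, ← Complex.ofReal_cpow (by linarith)]
    push_cast
    rfl
  have hEq : EqOn (complexMGF id ν) g U := by
    refine hf.eqOn_of_preconnected_of_frequently_eq hg
      (convex_halfSpace_re_lt 0).isPreconnected (z₀ := (-1 : ℂ)) (by simp [U]) ?_
    -- Identity theorem: the two functions agree on the negative reals, and these points accumulate
    -- at `-1` without hitting it.
    have ht : Tendsto (fun n : ℕ => ((-1 - 1 / ((n : ℝ) + 1) : ℝ) : ℂ)) atTop (𝓝[≠] (-1 : ℂ)) := by
      refine tendsto_nhdsWithin_iff.2 ⟨?_, Eventually.of_forall fun n => ?_⟩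
      · have := (tendsto_one_div_add_atTop_nhds_zero_nat (𝕜 := ℝ)).const_sub (-1)
        rw [sub_zero] at this
        simpa [Function.comp_def] using (Complex.continuous_ofReal.tendsto (-1 : ℝ)).comp this
      · have h : (0 : ℝ) < 1 / ((n : ℝ) + 1) := by positivity
        have h' : (-1 - 1 / ((n : ℝ) + 1) : ℝ) ≠ -1 := by linarith
        intro h2
        exact h' (Complex.ofReal_injective (by simpa using h2))
    refine ht.frequently (Frequently.of_forall fun n => hreal _ ?_)
    have h : (0 : ℝ) < 1 / ((n : ℝ) + 1) := by positivity
    linarith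
  -- Approach `θ i` from inside the half-plane. As `θ ≠ 0`, the limit stays off the branch cut of
  -- the power.
  set z : ℕ → ℂ := fun n => -((1 / ((n : ℝ) + 1) : ℝ) : ℂ) + θ * Complex.I
  have hzre : ∀ n, (z n).re = -(1 / ((n : ℝ) + 1)) := fun n => by
    simp only [z, Complex.add_re, Complex.neg_re, Complex.ofReal_re, Complex.mul_re, Complex.I_re,
      Complex.I_im, Complex.ofReal_im]
    ring
  have hzneg : ∀ n, (z n).re < 0 := fun n => by
    rw [hzre]
    have h : (0 : ℝ) < 1 / ((n : ℝ) + 1) := by positivity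
    linarith
  have hz : Tendsto z atTop (𝓝 (θ * Complex.I)) := by
    have := (Complex.continuous_ofReal.tendsto 0).comp
      (tendsto_one_div_add_atTop_nhds_zero_nat (𝕜 := ℝ))
    have := this.neg.add_const (θ * Complex.I)
    simpa [z, Function.comp_def] using this
  have hlim1 : Tendsto (fun n => complexMGF id ν (z n)) atTop
      (𝓝 (complexMGF id ν (θ * Complex.I))) := by
    refine tendsto_integral_of_dominated_convergence (fun _ => 1) (fun n => by fun_prop)
      (integrable_const _) (fun n => ?_) (ae_of_all _ fun x => ?_)
    · filter_upwards [hν] with x hx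
      rw [Complex.norm_exp]
      refine Real.exp_le_one_iff.2 ?_
      simp only [id, Complex.mul_re, Complex.ofReal_re, Complex.ofReal_im, mul_zero, sub_zero]
      exact mul_nonpos_of_nonpos_of_nonneg (hzneg n).le hx
    · exact (Complex.continuous_exp.tendsto _).comp (hz.mul_const _)
  have hlim2 : Tendsto (fun n => g (z n)) atTop (𝓝 (g (θ * Complex.I))) :=
    (hgan _ (Or.inr (by simpa using hθ))).continuousAt.tendsto.comp hz
  have := tendsto_nhds_unique (hlim1.congr fun n => hEq (hzneg n)) hlim2
  rw [← complexMGF_id_mul_I, this]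

/-- The argument of `-θ i` is `±π/2`, so the real part of its `α`-th power is `|θ| ^ α * cos (π α /
2)`. -/
lemma norm_exp_neg_cpow {c α θ : ℝ} (hθ : θ ≠ 0) :
    ‖Complex.exp (-c * (-(θ * Complex.I)) ^ (α : ℂ))‖ =
      Real.exp (-(c * Real.cos (Real.pi / 2 * α)) * |θ| ^ α) := by
  have h0 : -(θ * Complex.I) ≠ 0 := by simpa using hθ
  have hn : ‖-(θ * Complex.I)‖ = |θ| := by simp
  rw [Complex.norm_exp]
  congr 1
  have hre : ((-(θ * Complex.I)) ^ (α : ℂ)).re = |θ| ^ α * Real.cos (Real.pi / 2 * α) := by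
    rw [Complex.cpow_ofReal_re, hn]
    congr 1
    rcases lt_or_gt_of_ne hθ with h | h
    · have : -(θ * Complex.I) = ((-θ : ℝ) : ℂ) * Complex.I := by push_cast; ring
      rw [this, Complex.arg_real_mul _ (by linarith), Complex.arg_I]
    · have : -(θ * Complex.I) = (θ : ℂ) * (-Complex.I) := by ring
      rw [this, Complex.arg_real_mul _ h, Complex.arg_neg_I, neg_mul, Real.cos_neg]
  rw [← Complex.ofReal_neg, Complex.re_ofReal_mul, hre]
  ring

lemma integrable_exp_neg_mul_abs_rpow {b α : ℝ} (hb : 0 < b) (hα : 0 < α) :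
    Integrable fun x : ℝ => Real.exp (-b * |x| ^ α) := by
  have h : IntegrableOn (fun x : ℝ => Real.exp (-b * |x| ^ α)) (Ioi 0) := by
    have : IntegrableOn (fun x : ℝ => Real.exp (-b * x ^ α)) (Ioi 0) := by
      -- A non-integrable function would have Bochner integral zero, whereas the Gamma formula gives
      -- a positive value.
      by_contra hn
      have h1 := integral_undef hn
      rw [integral_exp_neg_mul_rpow hα hb] at h1
      have : 0 < b ^ (-1 / α) * Real.Gamma (1 / α + 1) := by
        have := Real.Gamma_pos_of_pos (show 0 < 1 / α + 1 by positivity)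
        positivity
      exact this.ne' h1
    refine this.congr_fun (fun x hx => ?_) measurableSet_Ioi
    simp only [abs_of_pos (mem_Ioi.1 hx)]
  rw [← integrableOn_univ, ← Iic_union_Ioi (a := (0 : ℝ)), integrableOn_union]
  refine ⟨?_, h⟩
  rw [integrableOn_Iic_iff_integrableOn_Iio]
  rw [← neg_zero] at h
  simpa using h.comp_neg_Iio

end

/-! ### One-dimensional laws of the subordinator and of the absorbed process. -/

/-- A finite measure that is absolutely continuous has a finite nonnegative density. -/
lemma exists_density_of_absolutelyContinuous {ν μ : Measure ℝ} [IsFiniteMeasure ν] [SigmaFinite μ]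
    (h : ν ≪ μ) :
    ∃ f : ℝ → ℝ, Measurable f ∧ (∀ x, 0 ≤ f x) ∧
      ν = μ.withDensity fun x => ENNReal.ofReal (f x) := by
  refine ⟨fun x => (ν.rnDeriv μ x).toReal, (Measure.measurable_rnDeriv ν μ).ennreal_toReal,
    fun x => ENNReal.toReal_nonneg, ?_⟩
  conv_lhs => rw [← Measure.withDensity_rnDeriv_eq ν μ h]
  refine withDensity_congr_ae ?_
  filter_upwards [Measure.rnDeriv_lt_top ν μ] with x hx
  exact (ENNReal.ofReal_toReal hx.ne).symm

lemma map_sub_mul_withDensity {f : ℝ → ENNReal} (hf : Measurable f) (t : ℝ) {c : ℝ} (hc : 0 < c) :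
    (volume.withDensity f).map (fun x => t - c * x) =
      volume.withDensity fun r => ENNReal.ofReal c⁻¹ * f (c⁻¹ * (t - r)) := by
  have hmap : (volume : Measure ℝ).map (fun x => t - c * x) = ENNReal.ofReal c⁻¹ • volume := by
    have h1 : (fun x => t - c * x) = (fun x => t - x) ∘ (fun x => c * x) := rfl
    rw [h1, ← Measure.map_map (by fun_prop) (by fun_prop), Real.map_volume_mul_left hc.ne',
      Measure.map_smul, Measure.map_sub_left_eq_self, abs_of_pos (inv_pos.2 hc)]
  refine Measure.ext fun B hB => ?_
  have hm : Measurable fun x : ℝ => t - c * x := by fun_prop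
  rw [Measure.map_apply hm hB, withDensity_apply _ (hm hB), withDensity_apply _ hB,
    lintegral_const_mul _ (by fun_prop), ← smul_eq_mul, ← lintegral_smul_measure,
    ← Measure.restrict_smul, ← hmap,
    setLIntegral_map hB (by fun_prop) hm]
  congr 1
  ext x
  congr 1
  field_simp
  ring

variable {Ω : Type*} [MeasurableSpace Ω] {P : Measure Ω} {α : ℝ} {S : ℝ≥0 → Ω → ℝ}

namespace IsStableSubordinator

lemma ae_nonneg (hS : IsStableSubordinator α S P) : ∀ᵐ ω ∂P, ∀ s, 0 ≤ S s ω := by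
  filter_upwards [hS.start, hS.mono] with ω h0 hm s
  rw [← h0]
  exact hm zero_le

lemma laplace_map (hS : IsStableSubordinator α S P) (s : ℝ≥0) (l : ℝ) (hl : 0 ≤ l) :
    ∫ x, Real.exp (-l * x) ∂(P.map (S s)) = Real.exp (-(s : ℝ) * l ^ α) := by
  rw [integral_map (hS.measurable s).aemeasurable (by fun_prop)]
  have := hS.laplace 0 s zero_le l hl
  simp only [NNReal.coe_zero, sub_zero] at this
  rw [← this]
  refine integral_congr_ae ?_
  filter_upwards [hS.start] with ω h0
  rw [h0, sub_zero]

lemma charFun_map [IsProbabilityMeasure P] (hS : IsStableSubordinator α S P) (s : ℝ≥0) {θ : ℝ}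
    (hθ : θ ≠ 0) :
    charFun (P.map (S s)) θ = Complex.exp (-((s : ℝ) : ℂ) * (-(θ * Complex.I)) ^ (α : ℂ)) := by
  have := Measure.isProbabilityMeasure_map (μ := P) (hS.measurable s).aemeasurable
  refine charFun_eq_of_laplace _ ?_ (hS.laplace_map s) hθ
  rw [ae_map_iff (hS.measurable s).aemeasurable measurableSet_Ici]
  filter_upwards [hS.ae_nonneg] with ω h using h s

/-- Self-similarity of the stable subordinator. -/
lemma map_eq_map_mul [IsProbabilityMeasure P] (hS : IsStableSubordinator α S P) (hα : 0 < α)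
    (s : ℝ≥0) :
    P.map (S s) = P.map fun ω => (s : ℝ) ^ α⁻¹ * S 1 ω := by
  have hm : Measurable fun ω => (s : ℝ) ^ α⁻¹ * S 1 ω := (hS.measurable 1).const_mul _
  have := Measure.isProbabilityMeasure_map (μ := P) (hS.measurable s).aemeasurable
  have := Measure.isProbabilityMeasure_map (μ := P) hm.aemeasurable
  refine Measure.ext_of_charFun (funext fun θ => ?_)
  rcases eq_or_ne θ 0 with rfl | hθ
  · simp
  rw [hS.charFun_map s hθ]
  refine (charFun_eq_of_laplace _ ?_ (fun l hl => ?_) hθ).symm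
  · rw [ae_map_iff hm.aemeasurable measurableSet_Ici]
    filter_upwards [hS.ae_nonneg] with ω h
    have := h 1
    positivity
  -- Evaluating the Laplace transform at `l * s ^ (1/α)` turns `l ^ α` into `s * l ^ α`.
  · have h1 := hS.laplace_map 1 (l * (s : ℝ) ^ α⁻¹) (by positivity)
    rw [integral_map (hS.measurable 1).aemeasurable (by fun_prop)] at h1
    rw [integral_map hm.aemeasurable (by fun_prop)]
    rw [Real.mul_rpow hl (by positivity), ← Real.rpow_mul s.coe_nonneg,
      inv_mul_cancel₀ hα.ne', Real.rpow_one] at h1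
    rw [show -(s : ℝ) * l ^ α = -((1 : ℝ≥0) : ℝ) * (l ^ α * s) by push_cast; ring, ← h1]
    congr 1
    ext ω
    congr 1
    ring

lemma map_absolutelyContinuous [IsProbabilityMeasure P] (hS : IsStableSubordinator α S P)
    (hα : α ∈ Ioo (0 : ℝ) 1) {s : ℝ≥0} (hs : 0 < s) : P.map (S s) ≪ volume := by
  have := Measure.isProbabilityMeasure_map (μ := P) (hS.measurable s).aemeasurable
  refine absolutelyContinuous_of_integrable_charFun _ ?_
  have hcos : 0 < Real.cos (Real.pi / 2 * α) := by
    refine Real.cos_pos_of_mem_Ioo ⟨?_, ?_⟩ <;> nlinarith [Real.pi_pos, hα.1, hα.2]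
  have hb : 0 < (s : ℝ) * Real.cos (Real.pi / 2 * α) := mul_pos (by exact_mod_cast hs) hcos
  refine (integrable_exp_neg_mul_abs_rpow hb hα.1).mono'
    stronglyMeasurable_charFun.aestronglyMeasurable ?_
  have h0 : ∀ᵐ θ : ℝ, θ ≠ 0 := Measure.ae_ne volume 0
  filter_upwards [h0] with θ hθ
  rw [hS.charFun_map s hθ, norm_exp_neg_cpow hθ]

lemma ae_pos [IsProbabilityMeasure P] (hS : IsStableSubordinator α S P)
    (hα : α ∈ Ioo (0 : ℝ) 1) {s : ℝ≥0} (hs : 0 < s) : ∀ᵐ ω ∂P, 0 < S s ω := by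
  have h0 : ∀ᵐ ω ∂P, S s ω ≠ 0 := by
    have : ∀ᵐ x ∂(P.map (S s)), x ≠ 0 :=
      (hS.map_absolutelyContinuous hα hs).ae_le (Measure.ae_ne volume 0)
    exact ae_of_ae_map (hS.measurable s).aemeasurable this
  filter_upwards [h0, hS.ae_nonneg] with ω h1 h2
  exact lt_of_le_of_ne (h2 s) h1.symm

/-- Chernoff bound: `E exp (-S n) = exp (-n)`, so the probability of staying below `t` forever is at
most `exp (|t| - n)` for every `n`. -/
lemma ae_exists_le [IsProbabilityMeasure P] (hS : IsStableSubordinator α S P) (t : ℝ) :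
    ∀ᵐ ω ∂P, ∃ n : ℕ, t ≤ S n ω := by
  have hle : ∀ n : ℕ, P.real {ω | ∀ n : ℕ, S n ω < t} ≤ Real.exp |t| * Real.exp (-(n : ℝ)) := by
    intro n
    have hm : MeasurableSet {ω | ∀ n : ℕ, S n ω < t} := by
      rw [ofPred_forall]
      exact MeasurableSet.iInter fun n => measurableSet_lt (hS.measurable n) measurable_const
    have hL := hS.laplace_map n 1 zero_le_one
    rw [integral_map (hS.measurable n).aemeasurable (by fun_prop), Real.one_rpow, mul_one] at hL
    simp only [NNReal.coe_natCast] at hL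
    rw [← hL, ← integral_const_mul, ← integral_indicator_one hm]
    have hi : Integrable (fun ω => Real.exp (-1 * S n ω)) P := by
      by_contra h
      rw [integral_undef h] at hL
      exact (Real.exp_pos _).ne hL
    refine integral_mono ((integrable_const 1).indicator hm) (hi.const_mul _) fun ω => ?_
    by_cases hω : ω ∈ {ω | ∀ n : ℕ, S n ω < t}
    · simp only [indicator_of_mem hω, Pi.one_apply, ← Real.exp_add]
      refine Real.one_le_exp ?_
      have := hω n
      have := le_abs_self t
      linarith
    · simp only [indicator_of_notMem hω]
      positivity
  have hlim : Tendsto (fun n : ℕ => Real.exp |t| * Real.exp (-(n : ℝ))) atTop (𝓝 0) := by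
    have := (Real.tendsto_exp_neg_atTop_nhds_zero.comp
      (tendsto_natCast_atTop_atTop (R := ℝ))).const_mul (Real.exp |t|)
    simpa using this
  have h0 := le_antisymm (ge_of_tendsto' hlim hle) measureReal_nonneg
  rw [measureReal_eq_zero_iff] at h0
  rw [ae_iff]
  simpa using h0

/-- Choosing a density separately for each `s` would not give joint measurability in `(s, r)`.
Self-similarity avoids this: one density `g` of `S 1` is rescaled by `s ^ (1/α)`. -/
lemma exists_isAbsorbedDensity [IsProbabilityMeasure P] (hS : IsStableSubordinator α S P)
    (hα : α ∈ Ioo (0 : ℝ) 1) : ∃ p, IsAbsorbedDensity S P p := by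
  have := Measure.isProbabilityMeasure_map (μ := P) (hS.measurable 1).aemeasurable
  obtain ⟨g, hg, hg0, hgS⟩ := exists_density_of_absolutelyContinuous
    (hS.map_absolutelyContinuous hα (s := 1) zero_lt_one)
  refine ⟨fun s t r => (s ^ α⁻¹)⁻¹ * g ((s ^ α⁻¹)⁻¹ * (t - r)), fun t _ => by fun_prop,
    fun s t r hs _ _ => mul_nonneg (by positivity) (hg0 _), fun s t hs ht => ?_⟩
  have hs' : (0 : ℝ) < s := by exact_mod_cast hs
  have hc : 0 < (s : ℝ) ^ α⁻¹ := by positivity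
  have hma : Measurable (absorbed t S s) := ((hS.measurable s).const_sub t).max measurable_const
  have hms : Measurable fun ω => t - S s ω := (hS.measurable s).const_sub t
  have h1 : (P.map (absorbed t S s)).restrict (Ioi 0) =
      (P.map fun ω => t - S s ω).restrict (Ioi 0) := by
    refine Measure.ext fun B hB => ?_
    rw [Measure.restrict_apply hB, Measure.restrict_apply hB,
      Measure.map_apply hma (hB.inter measurableSet_Ioi),
      Measure.map_apply hms (hB.inter measurableSet_Ioi)]
    congr 1
    ext ω
    simp only [absorbed, mem_preimage, mem_inter_iff, mem_Ioi, lt_max_iff, lt_irrefl, or_false]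
    refine and_congr_left fun h => ?_
    rw [max_eq_left h.le]
  have h2 : (P.map fun ω => t - S s ω) = (P.map (S 1)).map fun x => t - (s : ℝ) ^ α⁻¹ * x := by
    rw [Measure.map_map (by fun_prop) (hS.measurable 1)]
    have : (P.map fun ω => t - S s ω) = (P.map (S s)).map fun x => t - x := by
      rw [Measure.map_map (by fun_prop) (hS.measurable s)]; rfl
    rw [this, hS.map_eq_map_mul hα.1 s, Measure.map_map (by fun_prop)
      ((hS.measurable 1).const_mul _)]
    rfl
  rw [h1, h2, hgS, map_sub_mul_withDensity (by fun_prop) t hc,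
    restrict_withDensity measurableSet_Ioi]
  congr 1
  ext r
  rw [ENNReal.ofReal_mul (by positivity)]

/-- The almost sure description of the exit time of the absorbed process. -/
lemma ae_exitTime [IsProbabilityMeasure P] (hS : IsStableSubordinator α S P)
    {t : ℝ} (ht : 0 < t) :
    ∀ᵐ ω ∂P, 0 < exitTime (absorbed t S) ω ∧
      ∀ s, 0 < s → (exitTime (absorbed t S) ω ≤ s ↔ absorbed t S s ω ≤ 0) := by
  filter_upwards [hS.start, hS.mono, hS.rightCont, hS.ae_exists_le t] with ω h0 hm hr ⟨n, hn⟩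
  have habs : ∀ s, absorbed t S s ω ≤ 0 ↔ t ≤ S s ω := fun s => by simp [absorbed]
  set A : Set ℝ≥0 := {s | 0 < s ∧ absorbed t S s ω ≤ 0}
  have hpos : ∀ s, t ≤ S s ω → 0 < s := fun s hs => by
    rcases eq_or_ne s 0 with rfl | h
    · rw [h0] at hs; exact absurd ht (not_lt.2 hs)
    · exact pos_iff_ne_zero.2 h
  have hne : A.Nonempty := ⟨n, hpos _ hn, (habs _).2 hn⟩
  have hτ : exitTime (absorbed t S) ω = sInf A := rfl
  -- The level is reached at the infimum itself, by right-continuity; this makes the equivalence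
  -- below hold with `≤`.
  have hreach : t ≤ S (sInf A) ω := by
    have hev : ∀ᶠ u in 𝓝[>] (sInf A), t ≤ S u ω := by
      filter_upwards [self_mem_nhdsWithin] with u hu
      obtain ⟨v, hv, hvu⟩ := exists_lt_of_csInf_lt hne hu
      exact ((habs v).1 hv.2).trans (hm hvu.le)
    exact ge_of_tendsto ((hr (sInf A)).mono Ioi_subset_Ici_self) hev
  rw [hτ]
  refine ⟨hpos _ hreach, fun s hs => ?_⟩
  rw [habs]
  exact ⟨fun h => hreach.trans (hm h), fun h => csInf_le (OrderBot.bddBelow A) ⟨hs, (habs s).2 h⟩⟩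

end IsStableSubordinator

/-! ### Measurability and law of the exit time. -/

/-- The exit time as a measurable functional of the path, for nonincreasing paths. -/
noncomputable def pathExitTime (f : ℝ≥0 → ℝ) : ℝ≥0 :=
  (⨅ q : ℚ, if 0 < q ∧ f (q : ℝ).toNNReal ≤ 0 then (((q : ℝ).toNNReal : ℝ≥0) : ENNReal)
    else ⊤).toNNReal

lemma measurable_pathExitTime : Measurable pathExitTime := by
  refine Measurable.ennreal_toNNReal (Measurable.iInf fun q => ?_)
  refine Measurable.ite ?_ measurable_const measurable_const
  exact (MeasurableSet.const _).inter (measurableSet_le (measurable_pi_apply _) measurable_const)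

/-- Along a nonincreasing path the times spent at or below zero form an upward closed set, so
rational times give the same infimum; only countably many coordinates are then involved. -/
lemma exitTime_eq_pathExitTime {Ω : Type*} {X : ℝ≥0 → Ω → ℝ} {ω : Ω} (hX : Antitone fun s => X s ω)
    (hne : ∃ s, 0 < s ∧ X s ω ≤ 0) : exitTime X ω = pathExitTime fun s => X s ω := by
  set A : Set ℝ≥0 := {s | 0 < s ∧ X s ω ≤ 0}
  have hA : A.Nonempty := hne
  suffices h : ((sInf A : ℝ≥0) : ENNReal) = ⨅ q : ℚ,
      if 0 < q ∧ X (q : ℝ).toNNReal ω ≤ 0 then (((q : ℝ).toNNReal : ℝ≥0) : ENNReal) else ⊤ by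
    rw [pathExitTime, ← h, ENNReal.toNNReal_coe]
    rfl
  refine le_antisymm (le_iInf fun q => ?_) ?_
  · split_ifs with hq
    · refine ENNReal.coe_le_coe.2 (csInf_le (OrderBot.bddBelow A) ⟨?_, hq.2⟩)
      exact Real.toNNReal_pos.2 (by exact_mod_cast hq.1)
    · exact le_top
  · refine le_of_forall_gt fun c hc => ?_
    obtain ⟨b, hb1, hb2⟩ := ENNReal.lt_iff_exists_nnreal_btwn.1 hc
    obtain ⟨v, hv, hvb⟩ := exists_lt_of_csInf_lt hA (ENNReal.coe_lt_coe.1 hb1)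
    obtain ⟨q, hq0, hvq, hqb⟩ := (NNReal.lt_iff_exists_rat_btwn _ _).1 hvb
    have hq : 0 < q ∧ X (q : ℝ).toNNReal ω ≤ 0 := by
      refine ⟨?_, (hX hvq.le).trans hv.2⟩
      have := Real.toNNReal_pos.1 (hv.1.trans hvq)
      exact_mod_cast this
    refine (iInf_le _ q).trans_lt ?_
    rw [if_pos hq]
    exact (ENNReal.coe_lt_coe.2 hqb).trans hb2

namespace IsStableSubordinator

lemma ae_exitTime_eq [IsProbabilityMeasure P] (hS : IsStableSubordinator α S P) {t : ℝ} (ht : 0 < t) :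
    exitTime (absorbed t S) =ᵐ[P] fun ω => pathExitTime fun s => absorbed t S s ω := by
  filter_upwards [hS.mono, hS.ae_exitTime ht] with ω hm ⟨h1, h2⟩
  refine exitTime_eq_pathExitTime (fun s u hsu => ?_) ⟨_, h1, (h2 _ h1).1 le_rfl⟩
  exact max_le_max (sub_le_sub_left (hm hsu) t) le_rfl

lemma measurable_absorbed (hS : IsStableSubordinator α S P) (t : ℝ) (s : ℝ≥0) :
    Measurable (absorbed t S s) := ((hS.measurable s).const_sub t).max measurable_const

lemma aemeasurable_exitTime [IsProbabilityMeasure P] (hS : IsStableSubordinator α S P)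
    {t : ℝ} (ht : 0 < t) : AEMeasurable (exitTime (absorbed t S)) P :=
  ⟨_, measurable_pathExitTime.comp (measurable_pi_lambda _ (hS.measurable_absorbed t)),
    hS.ae_exitTime_eq ht⟩

/-- The exit time has the law of `(t / S 1) ^ α`. -/
lemma map_exitTime [IsProbabilityMeasure P] (hS : IsStableSubordinator α S P)
    (hα : α ∈ Ioo (0 : ℝ) 1) {t : ℝ} (ht : 0 < t) :
    P.map (fun ω => (exitTime (absorbed t S) ω : ℝ)) = P.map fun ω => (t / S 1 ω) ^ α := by
  have hm1 : AEMeasurable (fun ω => (exitTime (absorbed t S) ω : ℝ)) P :=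
    (hS.aemeasurable_exitTime ht).coe_nnreal_real
  have hm2 : Measurable fun ω => (t / S 1 ω) ^ α := by
    have := hS.measurable 1
    fun_prop
  refine Measure.ext_of_Iic _ _ fun a => ?_
  rw [Measure.map_apply_of_aemeasurable hm1 measurableSet_Iic,
    Measure.map_apply hm2 measurableSet_Iic]
  have hp := hS.ae_pos hα (s := 1) zero_lt_one
  have hE := hS.ae_exitTime ht
  rcases le_or_gt a 0 with ha | ha
  · rw [measure_eq_zero_iff_ae_notMem.2, measure_eq_zero_iff_ae_notMem.2]
    · filter_upwards [hp] with ω h1 h2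
      have : 0 < (t / S 1 ω) ^ α := by positivity
      exact (h2.trans ha).not_gt this
    · filter_upwards [hE] with ω h1 h2
      have : (0 : ℝ) < exitTime (absorbed t S) ω := by exact_mod_cast h1.1
      exact (h2.trans ha).not_gt this
  · lift a to ℝ≥0 using ha.le
    have ha' : 0 < a := by exact_mod_cast ha
    -- The chain is `τ ≤ a`, iff `t ≤ S a`, in law `t ≤ a ^ (1/α) * S 1`, iff `(t / S 1) ^ α ≤ a`.
    calc P ((fun ω => (exitTime (absorbed t S) ω : ℝ)) ⁻¹' Iic (a : ℝ))
        = P (S a ⁻¹' Ici t) := by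
          refine measure_congr (eventuallyEq_set.2 ?_)
          filter_upwards [hE] with ω h
          have := h.2 a ha'
          simpa [absorbed] using this
      _ = P ((fun ω => (a : ℝ) ^ α⁻¹ * S 1 ω) ⁻¹' Ici t) := by
          rw [← Measure.map_apply (hS.measurable a) measurableSet_Ici, hS.map_eq_map_mul hα.1 a,
            Measure.map_apply ((hS.measurable 1).const_mul _) measurableSet_Ici]
      _ = _ := by
          refine measure_congr (eventuallyEq_set.2 ?_)
          filter_upwards [hp] with ω h
          simp only [mem_preimage, mem_Ici, mem_Iic]
          rw [← Real.le_rpow_inv_iff_of_pos (by positivity) ha.le hα.1, div_le_iff₀ h]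

lemma exists_isTimeDensity [IsProbabilityMeasure P] (hS : IsStableSubordinator α S P)
    (hα : α ∈ Ioo (0 : ℝ) 1) {t : ℝ} (ht : 0 < t) :
    ∃ μ, IsTimeDensity (exitTime (absorbed t S)) P μ := by
  have hm1 : AEMeasurable (fun ω => (exitTime (absorbed t S) ω : ℝ)) P :=
    (hS.aemeasurable_exitTime ht).coe_nnreal_real
  have hm2 : Measurable fun ω => (t / S 1 ω) ^ α := by
    have := hS.measurable 1
    fun_prop
  have hp := hS.ae_pos hα (s := 1) zero_lt_one
  have hac : P.map (fun ω => (exitTime (absorbed t S) ω : ℝ)) ≪ volume.restrict (Ioi 0) := by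
    rw [hS.map_exitTime hα ht]
    refine Measure.AbsolutelyContinuous.mk fun B hB hB0 => ?_
    rw [Measure.restrict_apply hB] at hB0
    -- The inverse `y ↦ t / y ^ (1/α)` is differentiable on `y > 0`, so it sends null sets to null
    -- sets, and `S 1` avoids these almost surely.
    set N := (fun y : ℝ => t / y ^ α⁻¹) '' (B ∩ Ioi 0)
    have hN : volume N = 0 := by
      refine addHaar_image_eq_zero_of_differentiableOn_of_addHaar_eq_zero volume
        (fun y hy => ?_) hB0
      have hy0 : 0 < y := hy.2
      refine DifferentiableAt.differentiableWithinAt ?_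
      exact (differentiableAt_const t).div (Real.differentiableAt_rpow_const_of_ne _ hy0.ne')
        (by positivity)
    have hSN : ∀ᵐ ω ∂P, S 1 ω ∉ N :=
      ae_of_ae_map (hS.measurable 1).aemeasurable
        ((hS.map_absolutelyContinuous hα zero_lt_one).ae_le
          (measure_eq_zero_iff_ae_notMem.1 hN))
    rw [Measure.map_apply hm2 hB, measure_eq_zero_iff_ae_notMem]
    filter_upwards [hSN, hp] with ω h1 h2 h3
    refine h1 ⟨(t / S 1 ω) ^ α, ⟨h3, ?_⟩, ?_⟩
    · exact mem_Ioi.2 (by positivity)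
    · simp only
      rw [← Real.rpow_mul (by positivity), mul_inv_cancel₀ hα.1.ne', Real.rpow_one]
      field_simp
  have := Measure.isProbabilityMeasure_map (μ := P) hm1
  obtain ⟨g, hg, hg0, h⟩ := exists_density_of_absolutelyContinuous hac
  exact ⟨g, hg, fun s _ => hg0 s, h⟩

end IsStableSubordinator

/-! ### Diffusion marginals and evaluation at an independent random time. -/

/-- The one-dimensional marginals of the diffusion have density `p s x`. -/
lemma IsDiffusionFrom.map_eq_withDensity [IsProbabilityMeasure P] {d : ℕ}
    {a : E d → Matrix (Fin d) (Fin d) ℝ} {p : ℝ → E d → E d → ℝ} (hp : IsDiffusionDensity a p)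
    {x : E d} {Y : ℝ≥0 → Ω → E d} (hY : IsDiffusionFrom p x Y P) {s : ℝ≥0} (hs : 0 < s) :
    P.map (Y s) = volume.withDensity fun y => ENNReal.ofReal (p s x y) := by
  have hs' : (0 : ℝ) < s := by exact_mod_cast hs
  have hm : Measurable fun y => p s x y :=
    hp.measurable.comp (measurable_const.prodMk (measurable_const.prodMk measurable_id))
  have hint : Integrable fun y => p s x y := by
    refine ⟨hm.aestronglyMeasurable, ?_⟩
    rw [hasFiniteIntegral_iff_ofReal (ae_of_all _ fun y => hp.nonneg s hs' x y), hp.mass s hs' x]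
    exact ENNReal.one_lt_top
  refine Measure.ext fun B hB => ?_
  have hle : (⨆ u : Iic (0 : ℝ≥0), MeasurableSpace.comap (Y u) inferInstance) ≤
      (inferInstance : MeasurableSpace Ω) :=
    iSup_le fun u => (hY.measurable u).comap_le
  -- The Markov property at time 0, where `Y` equals `x`, is integrated to remove the conditioning.
  have h1 := hY.markov 0 s hs B hB
  rw [zero_add] at h1
  have h2 := integral_condExp (μ := P) hle (f := (Y s ⁻¹' B).indicator fun _ => (1 : ℝ))
  have h3 : (fun ω => ∫ y in B, p s (Y 0 ω) y) =ᵐ[P] fun _ => ∫ y in B, p s x y := by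
    filter_upwards [hY.start] with ω h
    rw [h]
  rw [integral_congr_ae (h1.trans h3), integral_const, probReal_univ, one_smul,
    integral_indicator_const _ (hY.measurable s hB), smul_eq_mul, mul_one] at h2
  rw [Measure.map_apply (hY.measurable s) hB, withDensity_apply _ hB,
    ← ofReal_integral_eq_lintegral_ofReal hint.restrict
      (ae_of_all _ fun y => hp.nonneg s hs' x y), h2, ofReal_measureReal]

/-- Evaluation of a path at time `s` through its values at rational times just after `s`. -/
noncomputable def rightEval {F : Type*} [TopologicalSpace F] [Nonempty F] (s : ℝ≥0)
    (f : ℝ≥0 → F) : F :=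
  limUnder atTop fun n : ℕ => f (((⌊s * (n + 1)⌋₊ : ℝ≥0) + 1) / (n + 1))

/-- For each `n` the time used is a function of the integer `⌊s * (n + 1)⌋`, so joint measurability
reduces to countably many coordinate maps. -/
lemma measurable_rightEval {F : Type*} [TopologicalSpace F] [Nonempty F] [MeasurableSpace F]
    [BorelSpace F] [PolishSpace F] :
    Measurable fun q : ℝ≥0 × (ℝ≥0 → F) => rightEval q.1 q.2 := by
  refine (StronglyMeasurable.limUnder fun n => Measurable.stronglyMeasurable ?_).measurable
  have h : Measurable fun q : ℕ × (ℝ≥0 → F) => q.2 (((q.1 : ℝ≥0) + 1) / (n + 1)) :=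
    measurable_from_prod_countable_right fun k => measurable_pi_apply (((k : ℝ≥0) + 1) / (n + 1))
  exact h.comp ((Nat.measurable_floor.comp (measurable_fst.mul_const _)).prodMk measurable_snd)

lemma rightEval_eq {F : Type*} [TopologicalSpace F] [T2Space F] [Nonempty F] {f : ℝ≥0 → F}
    {s : ℝ≥0} (hf : ContinuousWithinAt f (Ici s) s) : rightEval s f = f s := by
  refine Tendsto.limUnder_eq (hf.tendsto.comp ?_)
  have hlow : ∀ n : ℕ, s ≤ ((⌊s * (n + 1)⌋₊ : ℝ≥0) + 1) / (n + 1) := fun n => by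
    rw [le_div_iff₀ (by positivity)]
    exact (Nat.lt_floor_add_one _).le
  have hup : ∀ n : ℕ, ((⌊s * (n + 1)⌋₊ : ℝ≥0) + 1) / (n + 1) ≤ s + 1 / (n + 1) := fun n => by
    rw [add_div]
    gcongr
    rw [div_le_iff₀ (by positivity)]
    exact Nat.floor_le (zero_le)
  refine tendsto_nhdsWithin_iff.2 ⟨?_, Eventually.of_forall hlow⟩
  refine tendsto_of_tendsto_of_tendsto_of_le_of_le tendsto_const_nhds ?_ hlow hup
  simpa using (tendsto_const_nhds (x := s)).add
    (tendsto_one_div_add_atTop_nhds_zero_nat (𝕜 := ℝ≥0))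

lemma _root_.Measurable.rightEval {A F : Type*} [MeasurableSpace A] [TopologicalSpace F]
    [Nonempty F] [MeasurableSpace F] [BorelSpace F] [PolishSpace F] {s : A → ℝ≥0}
    {f : A → ℝ≥0 → F} (hs : Measurable s) (hf : Measurable f) :
    Measurable fun a => rightEval (s a) (f a) :=
  measurable_rightEval.comp (hs.prodMk hf)

lemma lintegral_map_rightEval {F : Type*} [TopologicalSpace F] [Nonempty F] [MeasurableSpace F]
    [BorelSpace F] [PolishSpace F] {X : ℝ≥0 → Ω → F} (hX : ∀ s, Measurable (X s))
    (hXr : ∀ᵐ ω ∂P, ∀ s, ContinuousWithinAt (fun u => X u ω) (Ici s) s)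
    (s : ℝ≥0) {g : F → ENNReal} (hg : Measurable g) :
    ∫⁻ u, g (rightEval s u) ∂(P.map fun ω s => X s ω) = ∫⁻ r, g r ∂(P.map (X s)) := by
  have hx : Measurable fun ω s => X s ω := measurable_pi_lambda _ hX
  have hgr : Measurable fun u : ℝ≥0 → F => g (rightEval s u) :=
    hg.comp (measurable_const.rightEval measurable_id)
  rw [lintegral_map hgr hx, lintegral_map hg (hX s)]
  refine lintegral_congr_ae ?_
  filter_upwards [hXr] with ω hω
  rw [rightEval_eq (hω s)]

/-- The joint law of two independent processes evaluated at an independent random time. -/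
lemma lintegral_eval_independent_time [IsProbabilityMeasure P] {F G W : Type*}
    [TopologicalSpace F] [MeasurableSpace F] [BorelSpace F] [PolishSpace F]
    [TopologicalSpace G] [MeasurableSpace G] [BorelSpace G] [PolishSpace G] [MeasurableSpace W]
    {Z : Ω → W} {X : ℝ≥0 → Ω → F} {Y : ℝ≥0 → Ω → G} {τ : Ω → ℝ≥0} {T : W → ℝ≥0}
    (hZ : Measurable Z) (hX : ∀ s, Measurable (X s)) (hY : ∀ s, Measurable (Y s))
    (hT : Measurable T) (hτ : τ =ᵐ[P] fun ω => T (Z ω))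
    (hXr : ∀ᵐ ω ∂P, ∀ s, ContinuousWithinAt (fun u => X u ω) (Ici s) s)
    (hYr : ∀ᵐ ω ∂P, ∀ s, ContinuousWithinAt (fun u => Y u ω) (Ici s) s)
    (hZX : IndepFun Z (fun ω s => X s ω) P)
    (hZXY : IndepFun (fun ω => (Z ω, fun s => X s ω)) (fun ω s => Y s ω) P)
    {h : ℝ≥0 × F × G → ENNReal} (hh : Measurable h) :
    ∫⁻ ω, h (τ ω, X (τ ω) ω, Y (τ ω) ω) ∂P =
      ∫⁻ s, ∫⁻ r, ∫⁻ y, h (s, r, y) ∂(P.map (Y s)) ∂(P.map (X s)) ∂(P.map τ) := by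
  obtain ⟨ω₀⟩ : Nonempty Ω := nonempty_of_isProbabilityMeasure P
  have : Nonempty F := ⟨X 0 ω₀⟩
  have : Nonempty G := ⟨Y 0 ω₀⟩
  set x : Ω → ℝ≥0 → F := fun ω s => X s ω
  set y : Ω → ℝ≥0 → G := fun ω s => Y s ω
  have hx : Measurable x := measurable_pi_lambda _ hX
  have hy : Measurable y := measurable_pi_lambda _ hY
  have := Measure.isProbabilityMeasure_map (μ := P) hZ.aemeasurable
  have := Measure.isProbabilityMeasure_map (μ := P) hx.aemeasurable
  have := Measure.isProbabilityMeasure_map (μ := P) hy.aemeasurable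
  have hlaw : P.map (fun ω => ((Z ω, x ω), y ω)) = ((P.map Z).prod (P.map x)).prod (P.map y) := by
    rw [(indepFun_iff_map_prod_eq_prod_map_map (hZ.prodMk hx).aemeasurable hy.aemeasurable).1 hZXY,
      (indepFun_iff_map_prod_eq_prod_map_map hZ.aemeasurable hx.aemeasurable).1 hZX]
  have hk : Measurable fun q : ℝ≥0 × (ℝ≥0 → F) × (ℝ≥0 → G) =>
      h (q.1, rightEval q.1 q.2.1, rightEval q.1 q.2.2) := by
    refine hh.comp (measurable_fst.prodMk (Measurable.prodMk ?_ ?_))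
    · exact measurable_fst.rightEval measurable_snd.fst
    · exact measurable_fst.rightEval measurable_snd.snd
  have hk' : Measurable fun q : (W × (ℝ≥0 → F)) × (ℝ≥0 → G) =>
      h (T q.1.1, rightEval (T q.1.1) q.1.2, rightEval (T q.1.1) q.2) :=
    hk.comp ((hT.comp measurable_fst.fst).prodMk (measurable_fst.snd.prodMk measurable_snd))
  have hk2 : Measurable fun s : ℝ≥0 => ∫⁻ u, ∫⁻ v, h (s, rightEval s u, rightEval s v)
      ∂(P.map y) ∂(P.map x) := by
    have : Measurable fun q : ℝ≥0 × (ℝ≥0 → F) =>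
        ∫⁻ v, h (q.1, rightEval q.1 q.2, rightEval q.1 v) ∂(P.map y) :=
      Measurable.lintegral_prod_right' (f := fun q : (ℝ≥0 × (ℝ≥0 → F)) × (ℝ≥0 → G) =>
        h (q.1.1, rightEval q.1.1 q.1.2, rightEval q.1.1 q.2))
        (hk.comp (measurable_fst.fst.prodMk (measurable_fst.snd.prodMk measurable_snd)))
    exact this.lintegral_prod_right'
  calc ∫⁻ ω, h (τ ω, X (τ ω) ω, Y (τ ω) ω) ∂P
      = ∫⁻ ω, h (T (Z ω), rightEval (T (Z ω)) (x ω), rightEval (T (Z ω)) (y ω)) ∂P := by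
        refine lintegral_congr_ae ?_
        filter_upwards [hτ, hXr, hYr] with ω h1 h2 h3
        rw [h1, rightEval_eq (f := x ω) (h2 _), rightEval_eq (f := y ω) (h3 _)]
    _ = ∫⁻ q, h (T q.1.1, rightEval (T q.1.1) q.1.2, rightEval (T q.1.1) q.2)
          ∂(P.map (fun ω => ((Z ω, x ω), y ω))) :=
        (lintegral_map hk' ((hZ.prodMk hx).prodMk hy)).symm
    _ = ∫⁻ z, ∫⁻ u, ∫⁻ v, h (T z, rightEval (T z) u, rightEval (T z) v)
          ∂(P.map y) ∂(P.map x) ∂(P.map Z) := by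
        rw [hlaw, lintegral_prod _ hk'.aemeasurable,
          lintegral_prod _ hk'.lintegral_prod_right'.aemeasurable]
    _ = ∫⁻ s, ∫⁻ u, ∫⁻ v, h (s, rightEval s u, rightEval s v)
          ∂(P.map y) ∂(P.map x) ∂(P.map τ) := by
        have hTZ : P.map (fun ω => T (Z ω)) = (P.map Z).map T := (Measure.map_map hT hZ).symm
        rw [Measure.map_congr hτ, hTZ, lintegral_map hk2 hT]
    _ = _ := by
        -- At a deterministic time `rightEval` agrees almost surely with the process, so only its
        -- marginals remain.
        refine lintegral_congr fun s => ?_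
        have := Measure.isProbabilityMeasure_map (μ := P) (hY s).aemeasurable
        have h1 : ∀ r : F, Measurable fun w : G => h (s, r, w) := fun r =>
          hh.comp (measurable_const.prodMk (measurable_const.prodMk measurable_id))
        have h2 : Measurable fun r => ∫⁻ w, h (s, r, w) ∂(P.map (Y s)) :=
          Measurable.lintegral_prod_right' (f := fun q : F × G => h (s, q))
            (hh.comp measurable_prodMk_left)
        rw [← lintegral_map_rightEval hX hXr s h2]
        exact lintegral_congr fun u => lintegral_map_rightEval hY hYr s (h1 _)

lemma aemeasurable_eval_time {F : Type*} [TopologicalSpace F] [MeasurableSpace F] [BorelSpace F]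
    [PolishSpace F] [Nonempty F] {X : ℝ≥0 → Ω → F} {τ : Ω → ℝ≥0} (hX : ∀ s, Measurable (X s))
    (hXr : ∀ᵐ ω ∂P, ∀ s, ContinuousWithinAt (fun u => X u ω) (Ici s) s) (hτ : AEMeasurable τ P) :
    AEMeasurable (fun ω => X (τ ω) ω) P := by
  refine ⟨fun ω => rightEval (hτ.mk τ ω) fun s => X s ω,
    hτ.measurable_mk.rightEval (measurable_pi_lambda _ hX), ?_⟩
  filter_upwards [hτ.ae_eq_mk, hXr] with ω h1 h2
  rw [← h1, rightEval_eq (h2 _)]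

lemma lintegral_prod_prod_swap {A B C : Type*} [MeasurableSpace A] [MeasurableSpace B]
    [MeasurableSpace C] {μ : Measure A} {ν : Measure B} {ρ : Measure C} [SFinite μ] [SFinite ν]
    [SFinite ρ] {f : A × B × C → ENNReal} (hf : Measurable f) :
    ∫⁻ q, f q ∂(μ.prod (ν.prod ρ)) = ∫⁻ c, ∫⁻ a, ∫⁻ b, f (a, b, c) ∂ν ∂μ ∂ρ := by
  rw [lintegral_prod _ hf.aemeasurable]
  have h1 : ∀ a, ∫⁻ q, f (a, q) ∂(ν.prod ρ) = ∫⁻ c, ∫⁻ b, f (a, b, c) ∂ν ∂ρ := fun a =>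
    lintegral_prod_symm' _ (hf.comp measurable_prodMk_left)
  simp_rw [h1]
  refine lintegral_lintegral_swap (Measurable.aemeasurable ?_)
  exact Measurable.lintegral_prod_right' (f := fun q : (A × C) × B => f (q.1.1, q.2, q.1.2))
    (hf.comp (measurable_fst.fst.prodMk (measurable_snd.prodMk measurable_fst.snd)))

/-! ### Joint law on the boundary and the representation. -/

variable {β γ : ℝ} {Sβ Sγ : ℝ≥0 → Ω → ℝ}

lemma IsStableSubordinator.absorbed_rightCont (hS : IsStableSubordinator α S P) (t : ℝ) :
    ∀ᵐ ω ∂P, ∀ s, ContinuousWithinAt (fun u => absorbed t S u ω) (Ici s) s := by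
  filter_upwards [hS.rightCont] with ω h s
  have := h s
  unfold absorbed
  exact (continuousWithinAt_const.sub this).max continuousWithinAt_const

lemma IsStableSubordinator.map_absorbed_restrict (hS : IsStableSubordinator α S P)
    {p : ℝ → ℝ → ℝ → ℝ} (hp : IsAbsorbedDensity S P p) {t : ℝ} (ht : 0 < t) {s : ℝ≥0}
    (hs : 0 < s) :
    (P.map (absorbed t S s)).restrict (Ioi 0) =
      (volume.restrict (Ioo 0 t)).withDensity fun r => ENNReal.ofReal (p s t r) := by
  have hle : ∀ᵐ r ∂(P.map (absorbed t S s)), r ≤ t := by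
    rw [ae_map_iff (hS.measurable_absorbed t s).aemeasurable measurableSet_Iic]
    filter_upwards [hS.ae_nonneg] with ω h
    exact max_le (by linarith [h s]) ht.le
  -- The starting point `t` carries no mass, so the range `(0, t]` may be shrunk to the open
  -- interval.
  have hne : ∀ᵐ r ∂((P.map (absorbed t S s)).restrict (Ioi 0)), r ≠ t := by
    rw [hp.law s t hs ht]
    exact (withDensity_absolutelyContinuous _ _).ae_le (ae_restrict_of_ae (Measure.ae_ne volume t))
  have hmem : ∀ᵐ r ∂((P.map (absorbed t S s)).restrict (Ioi 0)), r ∈ Ioo 0 t := by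
    filter_upwards [hne, ae_restrict_of_ae hle, ae_restrict_mem measurableSet_Ioi] with r h1 h2 h3
    exact ⟨h3, lt_of_le_of_ne h2 h1⟩
  rw [← Measure.restrict_eq_self_of_ae_mem hmem, hp.law s t hs ht,
    restrict_withDensity measurableSet_Ioo, Measure.restrict_restrict measurableSet_Ioo,
    inter_eq_left.2 Ioo_subset_Ioi_self]

lemma ae_exitTime_lt_iff [IsProbabilityMeasure P] (hSβ : IsStableSubordinator β Sβ P)
    (hSγ : IsStableSubordinator γ Sγ P) {t₁ t₂ : ℝ} (ht₁ : 0 < t₁) (ht₂ : 0 < t₂) :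
    ∀ᵐ ω ∂P, exitTime (absorbed t₁ Sβ) ω < exitTime (absorbed t₂ Sγ) ω ↔
      0 < absorbed t₂ Sγ (exitTime (absorbed t₁ Sβ) ω) ω := by
  filter_upwards [hSβ.ae_exitTime ht₁, hSγ.ae_exitTime ht₂] with ω h1 h2
  rw [← not_le, h2.2 _ h1.1, not_le]

variable {d : ℕ} {a : E d → Matrix (Fin d) (Fin d) ℝ} {pY : ℝ → E d → E d → ℝ} {x : E d}
  {Y : ℝ≥0 → Ω → E d} {t₁ t₂ : ℝ} {p : ℝ → ℝ → ℝ → ℝ} {μ : ℝ → ℝ}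

lemma IsDiffusionFrom.rightCont (hY : IsDiffusionFrom pY x Y P) :
    ∀ᵐ ω ∂P, ∀ s, ContinuousWithinAt (fun u => Y u ω) (Ici s) s := by
  filter_upwards [hY.cont] with ω h s using h.continuousWithinAt

/-- The joint density of position, location and exit time. -/
def jointDensity {d : ℕ} (pY : ℝ → E d → E d → ℝ) (p : ℝ → ℝ → ℝ → ℝ) (μ : ℝ → ℝ) (x : E d) (t : ℝ)
    (q : ℝ × E d × ℝ) : ℝ :=
  pY q.2.2 x q.2.1 * p q.2.2 t q.1 * μ q.2.2

lemma measurable_jointDensity {τ : Ω → ℝ≥0} (hpY : IsDiffusionDensity a pY)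
    (hp : IsAbsorbedDensity S P p) (hμ : IsTimeDensity τ P μ) {t : ℝ} (ht : 0 < t) :
    Measurable (jointDensity pY p μ x t) := by
  refine Measurable.mul (Measurable.mul ?_ ?_) ?_
  · exact hpY.measurable.comp
      (measurable_snd.snd.prodMk (measurable_const.prodMk measurable_snd.fst))
  · exact (hp.measurable t ht).comp (measurable_snd.snd.prodMk measurable_fst)
  · exact hμ.measurable.comp measurable_snd.snd

/-- The test function `k` also sees the exit time, so indicators for `k` yield the full joint law of
position, location and time. -/
lemma lintegral_boundary [IsProbabilityMeasure P] (hSβ : IsStableSubordinator β Sβ P)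
    (hSγ : IsStableSubordinator γ Sγ P) (ht₁ : 0 < t₁) (ht₂ : 0 < t₂)
    (hpY : IsDiffusionDensity a pY) (hY : IsDiffusionFrom pY x Y P)
    (hX : IndepFun (fun ω s => absorbed t₁ Sβ s ω) (fun ω s => absorbed t₂ Sγ s ω) P)
    (hXY : IndepFun
      (fun ω => ((fun s => absorbed t₁ Sβ s ω), (fun s => absorbed t₂ Sγ s ω)))
      (fun ω s => Y s ω) P)
    (hp : IsAbsorbedDensity Sγ P p) (hμ : IsTimeDensity (exitTime (absorbed t₁ Sβ)) P μ)
    {k : ℝ × E d × ℝ → ENNReal} (hk : Measurable k) :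
    ∫⁻ ω in {ω | exitTime (absorbed t₁ Sβ) ω < exitTime (absorbed t₂ Sγ) ω},
      k (absorbed t₂ Sγ (exitTime (absorbed t₁ Sβ) ω) ω, Y (exitTime (absorbed t₁ Sβ) ω) ω,
        exitTime (absorbed t₁ Sβ) ω) ∂P =
      ∫⁻ q in Ioo 0 t₂ ×ˢ (univ ×ˢ Ioi 0),
        ENNReal.ofReal (jointDensity pY p μ x t₂ q) * k q := by
  set τ := exitTime (absorbed t₁ Sβ)
  set τ' := exitTime (absorbed t₂ Sγ)
  have hτ : AEMeasurable τ P := hSβ.aemeasurable_exitTime ht₁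
  have hτ' : AEMeasurable τ' P := hSγ.aemeasurable_exitTime ht₂
  have hpm := hp.measurable t₂ ht₂
  have hpYm : Measurable fun q : ℝ × E d => pY q.1 x q.2 :=
    hpY.measurable.comp (measurable_fst.prodMk (measurable_const.prodMk measurable_snd))
  -- Cutting off to `r > 0` encodes the order of the two exit times and discards the atom at the
  -- absorbing point.
  set h : ℝ≥0 × ℝ × E d → ENNReal :=
    (univ ×ˢ (Ioi 0 ×ˢ univ)).indicator fun q => k (q.2.1, q.2.2, q.1)
  have hh : Measurable h := by
    refine Measurable.indicator ?_
      (MeasurableSet.univ.prod (measurableSet_Ioi.prod MeasurableSet.univ))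
    exact hk.comp (measurable_snd.fst.prodMk (measurable_snd.snd.prodMk
      (measurable_coe_nnreal_real.comp measurable_fst)))
  set K : ℝ → ENNReal := fun s => ∫⁻ r in Ioo 0 t₂, ∫⁻ y : E d,
    ENNReal.ofReal (p s t₂ r) * (ENNReal.ofReal (pY s x y) * k (r, y, s))
  have hKm : Measurable fun q : (ℝ × ℝ) × E d =>
      ENNReal.ofReal (p q.1.1 t₂ q.1.2) * (ENNReal.ofReal (pY q.1.1 x q.2) *
        k (q.1.2, q.2, q.1.1)) := by
    refine Measurable.mul ?_ (Measurable.mul ?_ ?_)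
    · exact (hpm.comp measurable_fst).ennreal_ofReal
    · exact (hpYm.comp (measurable_fst.fst.prodMk measurable_snd)).ennreal_ofReal
    · exact hk.comp (measurable_fst.snd.prodMk (measurable_snd.prodMk measurable_fst.fst))
  have hK : Measurable K := hKm.lintegral_prod_right'.lintegral_prod_right'
  have hinner : ∀ s : ℝ≥0, 0 < s →
      ∫⁻ r, ∫⁻ y, h (s, r, y) ∂(P.map (Y s)) ∂(P.map (absorbed t₂ Sγ s)) = K s := by
    intro s hs
    have h1 : ∀ r, ∫⁻ y, h (s, r, y) ∂(P.map (Y s)) = (Ioi (0 : ℝ)).indicator (fun r =>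
        ∫⁻ y, ENNReal.ofReal (pY s x y) * k (r, y, s)) r := by
      intro r
      have hk1 : Measurable fun y => k (r, y, (s : ℝ)) :=
        hk.comp (measurable_const.prodMk (measurable_id.prodMk measurable_const))
      by_cases hr : r ∈ Ioi (0 : ℝ)
      · rw [indicator_of_mem hr, hY.map_eq_withDensity hpY hs]
        have : ∀ y, h (s, r, y) = k (r, y, (s : ℝ)) := fun y =>
          indicator_of_mem (show (s, r, y) ∈ univ ×ˢ (Ioi 0 ×ˢ univ) from
            ⟨trivial, hr, trivial⟩) _
        simp_rw [this]
        have hd : Measurable fun y => ENNReal.ofReal (pY s x y) :=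
          (hpYm.comp measurable_prodMk_left).ennreal_ofReal
        rw [lintegral_withDensity_eq_lintegral_mul _ hd hk1]
        rfl
      · rw [indicator_of_notMem hr]
        have : ∀ y, h (s, r, y) = 0 := fun y =>
          indicator_of_notMem (fun hy => hr hy.2.1) _
        simp [this]
    have hm2 : Measurable fun q : ℝ × E d => ENNReal.ofReal (pY s x q.2) * k (q.1, q.2, s) :=
      (hpYm.comp (measurable_const.prodMk measurable_snd)).ennreal_ofReal.mul
        (hk.comp (measurable_fst.prodMk (measurable_snd.prodMk measurable_const)))
    have hd : Measurable fun r => ENNReal.ofReal (p s t₂ r) :=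
      (hpm.comp measurable_prodMk_left).ennreal_ofReal
    have hm3 : Measurable fun r => ∫⁻ y, ENNReal.ofReal (pY s x y) * k (r, y, s) :=
      hm2.lintegral_prod_right'
    simp_rw [h1]
    rw [lintegral_indicator measurableSet_Ioi, hSγ.map_absorbed_restrict hp ht₂ hs,
      lintegral_withDensity_eq_lintegral_mul _ hd hm3]
    refine lintegral_congr fun r => ?_
    exact (lintegral_const_mul _ (hm2.comp measurable_prodMk_left)).symm
  calc _ = ∫⁻ ω, h (τ ω, absorbed t₂ Sγ (τ ω) ω, Y (τ ω) ω) ∂P := by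
        rw [← lintegral_indicator₀ (nullMeasurableSet_lt hτ hτ')]
        refine lintegral_congr_ae ?_
        filter_upwards [ae_exitTime_lt_iff hSβ hSγ ht₁ ht₂] with ω hω
        by_cases hlt : τ ω < τ' ω
        · rw [indicator_of_mem (show ω ∈ {ω | τ ω < τ' ω} from hlt)]
          have hmem : (τ ω, absorbed t₂ Sγ (τ ω) ω, Y (τ ω) ω) ∈
            (univ ×ˢ (Ioi 0 ×ˢ univ) : Set (ℝ≥0 × ℝ × E d)) := ⟨trivial, hω.1 hlt, trivial⟩
          simp only [h, indicator_of_mem hmem]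
        · rw [indicator_of_notMem (show ω ∉ {ω | τ ω < τ' ω} from hlt)]
          exact (indicator_of_notMem (fun hy => hlt (hω.2 hy.2.1)) _).symm
    _ = ∫⁻ s, ∫⁻ r, ∫⁻ y, h (s, r, y) ∂(P.map (Y s)) ∂(P.map (absorbed t₂ Sγ s)) ∂(P.map τ) :=
        lintegral_eval_independent_time (measurable_pi_lambda _ (hSβ.measurable_absorbed t₁))
          (hSγ.measurable_absorbed t₂) hY.measurable measurable_pathExitTime
          (hSβ.ae_exitTime_eq ht₁) (hSγ.absorbed_rightCont t₂) hY.rightCont hX hXY hh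
    _ = ∫⁻ s, K s ∂(P.map τ) := by
        refine lintegral_congr_ae ?_
        have hpos : ∀ᵐ s ∂(P.map τ), 0 < s := by
          rw [ae_map_iff hτ measurableSet_Ioi]
          filter_upwards [hSβ.ae_exitTime ht₁] with ω hω using hω.1
        filter_upwards [hpos] with s hs using hinner s hs
    _ = ∫⁻ s, K s ∂(P.map fun ω => (τ ω : ℝ)) := by
        have hK' : Measurable fun s : ℝ≥0 => K s := hK.comp measurable_coe_nnreal_real
        rw [lintegral_map' hK'.aemeasurable hτ, lintegral_map' hK.aemeasurable hτ.coe_nnreal_real]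
    _ = ∫⁻ s in Ioi 0, ENNReal.ofReal (μ s) * K s := by
        rw [hμ.law, lintegral_withDensity_eq_lintegral_mul _ hμ.measurable.ennreal_ofReal hK]
        rfl
    _ = ∫⁻ s in Ioi 0, ∫⁻ r in Ioo 0 t₂, ∫⁻ y : E d,
          ENNReal.ofReal (jointDensity pY p μ x t₂ (r, y, s)) * k (r, y, s) := by
        refine setLIntegral_congr_fun measurableSet_Ioi fun s hs => ?_
        have hKs : Measurable fun q : ℝ × E d => ENNReal.ofReal (p s t₂ q.1) *
            (ENNReal.ofReal (pY s x q.2) * k (q.1, q.2, s)) :=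
          hKm.comp ((measurable_const.prodMk measurable_fst).prodMk measurable_snd)
        simp only [K]
        rw [← lintegral_const_mul _ hKs.lintegral_prod_right']
        refine setLIntegral_congr_fun measurableSet_Ioo fun r hr => ?_
        have hKr : Measurable fun y : E d => ENNReal.ofReal (p s t₂ r) *
            (ENNReal.ofReal (pY s x y) * k (r, y, s)) := hKs.comp measurable_prodMk_left
        simp only
        rw [← lintegral_const_mul _ hKr]
        refine lintegral_congr fun y => ?_
        have n1 := hpY.nonneg s hs x y
        have n2 := hp.nonneg s t₂ r hs ht₂ hr.1
        simp only [jointDensity]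
        rw [ENNReal.ofReal_mul (mul_nonneg n1 n2), ENNReal.ofReal_mul n1]
        ring
    _ = _ := by
        rw [Measure.volume_eq_prod, Measure.volume_eq_prod, ← Measure.prod_restrict,
          ← Measure.prod_restrict, Measure.restrict_univ]
        exact (lintegral_prod_prod_swap
          ((measurable_jointDensity hpY hp hμ ht₂).ennreal_ofReal.mul hk)).symm

/-- One of the two representations; the other one follows by exchanging the processes. -/
theorem boundaryTerm_representation [IsProbabilityMeasure P] (hSβ : IsStableSubordinator β Sβ P)
    (hSγ : IsStableSubordinator γ Sγ P) (ht₁ : 0 < t₁) (ht₂ : 0 < t₂)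
    (hpY : IsDiffusionDensity a pY) (hY : IsDiffusionFrom pY x Y P)
    (hX : IndepFun (fun ω s => absorbed t₁ Sβ s ω) (fun ω s => absorbed t₂ Sγ s ω) P)
    (hXY : IndepFun
      (fun ω => ((fun s => absorbed t₁ Sβ s ω), (fun s => absorbed t₂ Sγ s ω)))
      (fun ω s => Y s ω) P)
    (hp : IsAbsorbedDensity Sγ P p) (hμ : IsTimeDensity (exitTime (absorbed t₁ Sβ)) P μ)
    {φ : ℝ → E d → ℝ} (hφ : Measurable (Function.uncurry φ))
    (hint : Integrable (boundaryTerm φ (absorbed t₂ Sγ) Y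
      (exitTime (absorbed t₁ Sβ)) (exitTime (absorbed t₂ Sγ))) P) :
    IntegrableOn (fun q : ℝ × E d × ℝ =>
        φ q.1 q.2.1 * (pY q.2.2 x q.2.1 * p q.2.2 t₂ q.1 * μ q.2.2))
      (Ioo 0 t₂ ×ˢ (univ ×ˢ Ioi 0)) ∧
    ∫ ω, boundaryTerm φ (absorbed t₂ Sγ) Y
        (exitTime (absorbed t₁ Sβ)) (exitTime (absorbed t₂ Sγ)) ω ∂P =
      ∫ r in Ioo 0 t₂, ∫ y : E d,
        φ r y * ∫ s in Ioi (0 : ℝ), pY s x y * p s t₂ r * μ s := by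
  set τ := exitTime (absorbed t₁ Sβ)
  set τ' := exitTime (absorbed t₂ Sγ)
  have hτ : AEMeasurable τ P := hSβ.aemeasurable_exitTime ht₁
  have hτ' : AEMeasurable τ' P := hSγ.aemeasurable_exitTime ht₂
  set A : Set (ℝ × E d × ℝ) := Ioo 0 t₂ ×ˢ (univ ×ˢ Ioi 0)
  have hA : MeasurableSet A := measurableSet_Ioo.prod (MeasurableSet.univ.prod measurableSet_Ioi)
  set B : Set Ω := {ω | τ ω < τ' ω}
  have hB : NullMeasurableSet B P := nullMeasurableSet_lt hτ hτ'
  set Q : Ω → ℝ × E d × ℝ := fun ω => (absorbed t₂ Sγ (τ ω) ω, Y (τ ω) ω, τ ω)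
  have hQ : AEMeasurable Q (P.restrict B) :=
    ((aemeasurable_eval_time (hSγ.measurable_absorbed t₂) (hSγ.absorbed_rightCont t₂) hτ).prodMk
      ((aemeasurable_eval_time hY.measurable hY.rightCont hτ).prodMk hτ.coe_nnreal_real)).restrict
  have hDm := measurable_jointDensity (x := x) hpY hp hμ ht₂
  set D := jointDensity pY p μ x t₂
  have hlaw : (P.restrict B).map Q =
      (volume.restrict A).withDensity fun q => ENNReal.ofReal (D q) := by
    refine Measure.ext fun V hV => ?_
    rw [withDensity_apply _ hV, ← lintegral_indicator_one hV, lintegral_map'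
      (measurable_one.indicator hV).aemeasurable hQ,
      lintegral_boundary hSβ hSγ ht₁ ht₂ hpY hY hX hXY hp hμ (measurable_one.indicator hV),
      ← lintegral_indicator hV]
    refine lintegral_congr fun q => ?_
    by_cases hq : q ∈ V <;> simp [hq, D]
  set Φ : ℝ × E d × ℝ → ℝ := fun q => φ q.1 q.2.1
  have hΦ : Measurable Φ := hφ.comp (measurable_fst.prodMk measurable_snd.fst)
  have hterm : boundaryTerm φ (absorbed t₂ Sγ) Y τ τ' = B.indicator (Φ ∘ Q) := rfl
  have hnn : ∀ᵐ q ∂(volume.restrict A), (ENNReal.ofReal (D q)).toReal • Φ q =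
      φ q.1 q.2.1 * (pY q.2.2 x q.2.1 * p q.2.2 t₂ q.1 * μ q.2.2) := by
    filter_upwards [ae_restrict_mem hA] with q hq
    have hs : 0 < q.2.2 := hq.2.2
    have hD : 0 ≤ D q := mul_nonneg (mul_nonneg (hpY.nonneg _ hs _ _)
      (hp.nonneg _ _ _ hs ht₂ hq.1.1)) (hμ.nonneg _ hs)
    rw [ENNReal.toReal_ofReal hD, smul_eq_mul, mul_comm]
    rfl
  have hfin : ∀ᵐ q ∂(volume.restrict A), ENNReal.ofReal (D q) < ⊤ :=
    ae_of_all _ fun q => ENNReal.ofReal_lt_top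
  have hI : IntegrableOn (fun q : ℝ × E d × ℝ =>
      φ q.1 q.2.1 * (pY q.2.2 x q.2.1 * p q.2.2 t₂ q.1 * μ q.2.2)) A := by
    have hint' : Integrable (Φ ∘ Q) (P.restrict B) := by
      refine hint.restrict.congr ?_
      filter_upwards [ae_restrict_mem₀ hB] with ω hω
      rw [hterm, indicator_of_mem hω]
    have h1 := (integrable_map_measure hΦ.aestronglyMeasurable hQ).2 hint'
    rw [hlaw, integrable_withDensity_iff_integrable_smul' hDm.ennreal_ofReal hfin] at h1
    exact h1.congr hnn
  refine ⟨hI, ?_⟩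
  have hmap : ∫ ω in B, (Φ ∘ Q) ω ∂P = ∫ q, Φ q ∂((P.restrict B).map Q) :=
    (integral_map hQ hΦ.aestronglyMeasurable).symm
  rw [hterm, integral_indicator₀ hB, hmap, hlaw,
    integral_withDensity_eq_integral_toReal_smul hDm.ennreal_ofReal hfin,
    integral_congr_ae hnn]
  have hvol : (volume : Measure (ℝ × E d × ℝ)).restrict A =
      (volume.restrict (Ioo 0 t₂)).prod (volume.prod (volume.restrict (Ioi 0))) := by
    rw [Measure.volume_eq_prod, Measure.volume_eq_prod, ← Measure.prod_restrict,
      ← Measure.prod_restrict, Measure.restrict_univ]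
  rw [IntegrableOn, hvol] at hI
  -- Absolute convergence of the triple integral justifies Fubini, for the whole and for almost
  -- every slice in `r`.
  rw [hvol, integral_prod _ hI]
  refine integral_congr_ae ?_
  filter_upwards [hI.prod_right_ae] with r hr
  rw [integral_prod _ hr]
  simp only [integral_const_mul]

end MixedFractional

open MixedFractional in
theorem mainTheorem2
    {Ω : Type*} [MeasurableSpace Ω] (P : Measure Ω) [IsProbabilityMeasure P]
    (β γ : ℝ) (hβ : β ∈ Ioo (0 : ℝ) 1) (hγ : γ ∈ Ioo (0 : ℝ) 1)
    (t₁ t₂ : ℝ) (ht₁ : 0 < t₁) (ht₂ : 0 < t₂)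
    (Sβ Sγ : ℝ≥0 → Ω → ℝ)
    (hSβ : IsStableSubordinator β Sβ P) (hSγ : IsStableSubordinator γ Sγ P)
    (d : ℕ) (a : E d → Matrix (Fin d) (Fin d) ℝ) (ha : IsEllipticCoefficient a)
    (pY : ℝ → E d → E d → ℝ) (hpY : IsDiffusionDensity a pY)
    (x : E d) (Y : ℝ≥0 → Ω → E d) (hY : IsDiffusionFrom pY x Y P)
    (hX : IndepFun (fun ω s => absorbed t₁ Sβ s ω) (fun ω s => absorbed t₂ Sγ s ω) P)
    (hXY : IndepFun
      (fun ω => ((fun s => absorbed t₁ Sβ s ω), (fun s => absorbed t₂ Sγ s ω)))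
      (fun ω s => Y s ω) P) :
    -- the transition densities and the densities of the exit times exist
    (∃ pβ, IsAbsorbedDensity Sβ P pβ) ∧ (∃ pγ, IsAbsorbedDensity Sγ P pγ) ∧
    (∃ μβ, IsTimeDensity (exitTime (absorbed t₁ Sβ)) P μβ) ∧
    (∃ μγ, IsTimeDensity (exitTime (absorbed t₂ Sγ)) P μγ) ∧
    -- and, for any versions of them, the two representations hold
    ∀ (pβ pγ : ℝ → ℝ → ℝ → ℝ) (μβ μγ : ℝ → ℝ),
      IsAbsorbedDensity Sβ P pβ → IsAbsorbedDensity Sγ P pγ →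
      IsTimeDensity (exitTime (absorbed t₁ Sβ)) P μβ →
      IsTimeDensity (exitTime (absorbed t₂ Sγ)) P μγ →
      (∀ φ₁ : ℝ → E d → ℝ, Measurable (Function.uncurry φ₁) →
        Integrable (boundaryTerm φ₁ (absorbed t₂ Sγ) Y
          (exitTime (absorbed t₁ Sβ)) (exitTime (absorbed t₂ Sγ))) P →
        IntegrableOn (fun q : ℝ × E d × ℝ =>
            φ₁ q.1 q.2.1 * (pY q.2.2 x q.2.1 * pγ q.2.2 t₂ q.1 * μβ q.2.2))
          (Ioo 0 t₂ ×ˢ (univ ×ˢ Ioi 0)) ∧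
        ∫ ω, boundaryTerm φ₁ (absorbed t₂ Sγ) Y
            (exitTime (absorbed t₁ Sβ)) (exitTime (absorbed t₂ Sγ)) ω ∂P =
          ∫ r in Ioo 0 t₂, ∫ y : E d,
            φ₁ r y * ∫ s in Ioi (0 : ℝ), pY s x y * pγ s t₂ r * μβ s) ∧
      (∀ φ₂ : ℝ → E d → ℝ, Measurable (Function.uncurry φ₂) →
        Integrable (boundaryTerm φ₂ (absorbed t₁ Sβ) Y
          (exitTime (absorbed t₂ Sγ)) (exitTime (absorbed t₁ Sβ))) P →
        IntegrableOn (fun q : ℝ × E d × ℝ =>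
            φ₂ q.1 q.2.1 * (pY q.2.2 x q.2.1 * pβ q.2.2 t₁ q.1 * μγ q.2.2))
          (Ioo 0 t₁ ×ˢ (univ ×ˢ Ioi 0)) ∧
        ∫ ω, boundaryTerm φ₂ (absorbed t₁ Sβ) Y
            (exitTime (absorbed t₂ Sγ)) (exitTime (absorbed t₁ Sβ)) ω ∂P =
          ∫ r in Ioo 0 t₁, ∫ y : E d,
            φ₂ r y * ∫ s in Ioi (0 : ℝ), pY s x y * pβ s t₁ r * μγ s) := by
  refine ⟨hSβ.exists_isAbsorbedDensity hβ, hSγ.exists_isAbsorbedDensity hγ,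
    hSβ.exists_isTimeDensity hβ ht₁, hSγ.exists_isTimeDensity hγ ht₂, ?_⟩
  intro pβ pγ μβ μγ hpβ hpγ hμβ hμγ
  refine ⟨fun φ₁ hφ₁ hint => ?_, fun φ₂ hφ₂ hint => ?_⟩
  · exact boundaryTerm_representation hSβ hSγ ht₁ ht₂ hpY hY hX hXY hpγ hμβ hφ₁ hint
  -- The roles of the two processes are exchanged; independence from `Y` survives swapping the pair.
  · exact boundaryTerm_representation hSγ hSβ ht₂ ht₁ hpY hY hX.symm
      (hXY.comp measurable_swap measurable_id) hpβ hμγ hφ₂ hint
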